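/- Let $d\ge 0$ be an integer, let $\Omega\subset\mathbb R^d$ be compact and convex, and let $\mu,\nu\in L^\infty(\Omega)$ be two probability densities on $\Omega$. For a function $\varphi$ on $\Omega$ let $\varphi^c(x)=\inf_{y\in\Omega}\big(\tfrac12|y-x|^2-\varphi(y)\big)$ and $T_\varphi(x)=x-\nabla\varphi^c(x)$, and put $$J(\varphi)=\int_\Omega\varphi\,d\nu+\int_\Omega\varphi^c\,d\mu,\qquad I(\psi)=\int_\Omega\psi^c\,d\nu+\int_\Omega\psi\,d\mu,$$ and $D(\varphi,\psi)=\int_\Omega\varphi\,d\nu+\int_\Omega\psi\,d\mu$ if $\varphi(y)+\psi(x)\le\tfrac12|y-x|^2$ for all $x,y\in\Omega$, and $D(\varphi,\psi)=-\infty$ otherwise. The space $\dot H^1(\Omega)$ consists of the functions in $L^2(\Omega)$ with mean zero and weak gradient in $L^2(\Omega)$. The $\dot H^1$-gradients are $$\nabla_{\dot H^1}J(\varphi)=(-\Delta)^{-1}(\nu-T_{\varphi\#}\mu),\qquad \nabla_{\dot H^1}I(\psi)=(-\Delta)^{-1}(\mu-T_{\psi\#}\nu),$$ where the push-forward measures are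 identified with their densities on $\Omega$ (having such a density is part of what it means for the gradient to be defined), and $u=(-\Delta)^{-1}f$, with zero Neumann boundary conditions, means that $u\in\dot H^1(\Omega)$ and $\int_\Omega\nabla u\cdot\nabla v\,dx=\int_\Omega fv\,dx$ for all $v\in\dot H^1(\Omega)$. Let $\lambda>0$ and let $\mathcal S_\lambda$ be the set of continuous functions $\varphi$ on $\Omega$ that are twice differentiable in the interior of $\Omega$ with $(1-\lambda^{-1})\,\mathrm{Id}\le D^2\varphi(x)\le(1-\lambda)\,\mathrm{Id}$ there. Let $\sigma_n,\tau_n$ $(n\ge 0)$ be step sizes with $$0<\sigma_n\le\|\mu\|_{L^\infty}^{-1}\lambda^{d+1},\qquad 0<\tau_n\le\|\nu\|_{L^\infty}^{-1}\lambda^{d+1}$$ (for instance one fixed step size that satisfies both bounds). Let $\varphi_0=\psi_0=0$ and suppose that for all integers $n\ge0$ the back-and-forth updates $$\varphi_{n+\frac12}=\varphi_n+\sigma_n\nabla_{\dot H^1}J(\varphi_n),\quad \psi_{n+\frac12}=(\varphi_{n+\frac12})^c,\quad \psi_{n+1}=\psi_{n+\frac12}+\tau_n\nabla_{\dot H^1}I(\psi_{n+\frac12}),\quad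 \varphi_{n+1}=(\psi_{n+1})^c$$ hold on $\Omega$, the gradients that occur being defined. If all the iterates $\varphi_n,\varphi_{n+\frac12},\psi_n,\psi_{n+\frac12}$ lie in $\mathcal S_\lambda$, then for all integers $n\ge 0$ $$D(\varphi_{n+1},\psi_{n+1})\ge D(\varphi_{n+\frac12},\psi_{n+\frac12})\ge D(\varphi_n,\psi_n)$$ and $$I(\psi_{n+1})\ge I(\psi_{n+\frac12})\ge J(\varphi_{n+\frac12})\ge J(\varphi_n)\ge I(\psi_n).$$ -/

import Mathlib

open MeasureTheory Set
open scoped ENNReal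

noncomputable section

namespace BackAndForth

/-- The space `ℝ^d` with its Euclidean norm. -/
abbrev Rd (d : ℕ) : Type := EuclideanSpace ℝ (Fin d)

variable {d : ℕ}

/-- `μ` is a probability density supported in `Ω`. -/
structure IsProbDensity (Ω : Set (Rd d)) (μ : Rd d → ℝ) : Prop where
  measurable : Measurable μ
  nonneg : ∀ x, 0 ≤ μ x
  support : ∀ x, x ∉ Ω → μ x = 0
  integral_eq_one : ∫ x in Ω, μ x = 1

/-- The measure `μ(x) dx` on `Ω` with density `μ`. -/
def densityMeasure (Ω : Set (Rd d)) (μ : Rd d → ℝ) : Measure (Rd d) :=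
  (volume.restrict Ω).withDensity fun x => ENNReal.ofReal (μ x)

/-- The `L^∞` norm on `Ω`, a real number (it is used for essentially bounded functions only). -/
def linftyNorm (Ω : Set (Rd d)) (μ : Rd d → ℝ) : ℝ :=
  (eLpNorm μ ∞ (volume.restrict Ω)).toReal

/-- The quadratic cost `c(x, y) = |y - x|² / 2`. -/
def cost (x y : Rd d) : ℝ := ‖y - x‖ ^ 2 / 2

/-- The `c`-transform `φ^c(x) = inf_{y ∈ Ω} (c(x, y) - φ(y))`. It only involves the values of `φ`
on `Ω`. (The quadratic cost is symmetric, so the transforms in both variables coincide.) -/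
def cTransform (Ω : Set (Rd d)) (φ : Rd d → ℝ) (x : Rd d) : ℝ :=
  ⨅ y : Ω, (cost x (y : Rd d) - φ y)

/-- The map `T_φ(x) = x - ∇φ^c(x)` (the general formula is `x - (∇h)⁻¹(∇φ^c(x))`, and
`∇h` is the identity for `h(z) = |z|² / 2`). -/
def transportMap (Ω : Set (Rd d)) (φ : Rd d → ℝ) (x : Rd d) : Rd d :=
  x - gradient (cTransform Ω φ) x

/-- `J(φ) = ∫ φ dν + ∫ φ^c dμ`. -/
def J (Ω : Set (Rd d)) (μ ν φ : Rd d → ℝ) : ℝ :=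
  (∫ y in Ω, φ y * ν y) + ∫ x in Ω, cTransform Ω φ x * μ x

/-- `I(ψ) = ∫ ψ^c dν + ∫ ψ dμ`. -/
def I (Ω : Set (Rd d)) (μ ν ψ : Rd d → ℝ) : ℝ :=
  (∫ y in Ω, cTransform Ω ψ y * ν y) + ∫ x in Ω, ψ x * μ x

/-- The constraint set of the dual problem. -/
def constraintSet (Ω : Set (Rd d)) : Set ((Rd d → ℝ) × (Rd d → ℝ)) :=
  {p | ∀ x ∈ Ω, ∀ y ∈ Ω, p.1 y + p.2 x ≤ cost x y}

open Classical in
/-- The convex indicator function of the constraint set: `0` on it and `+∞` elsewhere. -/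
def constraintIndicator (Ω : Set (Rd d)) (φ ψ : Rd d → ℝ) : EReal :=
  if (φ, ψ) ∈ constraintSet Ω then 0 else ⊤

/-- The symmetric dual functional `D(φ, ψ) = ∫ φ ν + ∫ ψ μ - ι(φ, ψ)`, with values in
`ℝ ∪ {-∞}`. -/
def D (Ω : Set (Rd d)) (μ ν φ ψ : Rd d → ℝ) : EReal :=
  (((∫ y in Ω, φ y * ν y) + ∫ x in Ω, ψ x * μ x : ℝ) : EReal) - constraintIndicator Ω φ ψ

/-- The class `S_lam`: functions continuous on `Ω` and twice differentiable inside `Ω`, with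
`(1 - lam⁻¹) Id ≤ D²φ(x) ≤ (1 - lam) Id`. -/
structure MemS (Ω : Set (Rd d)) (lam : ℝ) (φ : Rd d → ℝ) : Prop where
  continuousOn : ContinuousOn φ Ω
  differentiableOn : DifferentiableOn ℝ φ (interior Ω)
  differentiableOn_fderiv : DifferentiableOn ℝ (fderiv ℝ φ) (interior Ω)
  lower : ∀ x ∈ interior Ω, ∀ v : Rd d,
    (1 - lam⁻¹) * ‖v‖ ^ 2 ≤ fderiv ℝ (fderiv ℝ φ) x v v
  upper : ∀ x ∈ interior Ω, ∀ v : Rd d,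
    fderiv ℝ (fderiv ℝ φ) x v v ≤ (1 - lam) * ‖v‖ ^ 2

/-- `G` is the weak (distributional) gradient of `u` inside `Ω`. -/
def IsWeakGradient (Ω : Set (Rd d)) (u : Rd d → ℝ) (G : Rd d → Rd d) : Prop :=
  ∀ η : Rd d → ℝ, ContDiff ℝ (⊤ : ℕ∞) η → HasCompactSupport η → tsupport η ⊆ interior Ω →
    ∀ e : Rd d, ∫ x in Ω, u x * fderiv ℝ η x e = - ∫ x in Ω, η x * inner ℝ (G x) e

/-- `u` belongs to the homogeneous Sobolev space `Ḣ¹(Ω)` (zero mean, square integrable weak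
gradient) and `G` is its weak gradient. -/
structure HasH1Gradient (Ω : Set (Rd d)) (u : Rd d → ℝ) (G : Rd d → Rd d) : Prop where
  memLp : MemLp u 2 (volume.restrict Ω)
  mean_zero : ∫ x in Ω, u x = 0
  memLp_gradient : MemLp G 2 (volume.restrict Ω)
  isWeakGradient : IsWeakGradient Ω u G

/-- `u = (-Δ)⁻¹ f` with zero Neumann boundary conditions: `u ∈ Ḣ¹(Ω)` and
`∫ ∇u · ∇v = ∫ f v` for all `v ∈ Ḣ¹(Ω)`. -/
def IsNeumannSolution (Ω : Set (Rd d)) (f u : Rd d → ℝ) : Prop :=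
  ∃ G : Rd d → Rd d, HasH1Gradient Ω u G ∧
    ∀ (v : Rd d → ℝ) (H : Rd d → Rd d), HasH1Gradient Ω v H →
      IntegrableOn (fun x => f x * v x) Ω ∧
        ∫ x in Ω, inner ℝ (G x) (H x) = ∫ x in Ω, f x * v x

/-- `u = (-Δ)⁻¹ (ν - T_φ# μ)`, which is the `Ḣ¹`-gradient of `J` at `φ`. Here `T_φ# μ` is
identified with its density `ρ`. The `Ḣ¹`-gradient of `I` at `ψ` is obtained by exchanging the
roles of `μ` and `ν`. -/
def IsH1GradientAt (Ω : Set (Rd d)) (μ ν φ u : Rd d → ℝ) : Prop :=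
  ∃ ρ : Rd d → ℝ, IsProbDensity Ω ρ ∧
    (densityMeasure Ω μ).map (transportMap Ω φ) = densityMeasure Ω ρ ∧
    IsNeumannSolution Ω (fun x => ν x - ρ x) u

/-- The gradient step `φ' = φ + σ ∇J(φ)` on `Ω`, the gradient being taken in `Ḣ¹(Ω)`. -/
def IsGradientStep (Ω : Set (Rd d)) (μ ν : Rd d → ℝ) (σ : ℝ) (φ φ' : Rd d → ℝ) : Prop :=
  ∃ u : Rd d → ℝ, IsH1GradientAt Ω μ ν φ u ∧ ∀ x ∈ Ω, φ' x = φ x + σ * u x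

/-- The back-and-forth method: `φ n`, `ψ n` are the iterates with integer index `n`, and `φh n`,
`ψh n` those with index `n + 1/2`. The step sizes are `σ n` for the steps on `J` and `τ n` for the
steps on `I`. All functions are considered on `Ω` only. -/
structure IsBackAndForth (Ω : Set (Rd d)) (μ ν : Rd d → ℝ) (σ τ : ℕ → ℝ)
    (φ φh ψ ψh : ℕ → Rd d → ℝ) : Prop where
  φ_zero : ∀ x ∈ Ω, φ 0 x = 0
  ψ_zero : ∀ x ∈ Ω, ψ 0 x = 0
  φ_half : ∀ n, IsGradientStep Ω μ ν (σ n) (φ n) (φh n)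
  ψ_half : ∀ n, ∀ x ∈ Ω, ψh n x = cTransform Ω (φh n) x
  ψ_succ : ∀ n, IsGradientStep Ω ν μ (τ n) (ψh n) (ψ (n + 1))
  φ_succ : ∀ n, ∀ x ∈ Ω, φ (n + 1) x = cTransform Ω (ψ (n + 1)) x

end BackAndForth

end

/-!
# Monotonicity of the back-and-forth method

After a gradient step `φ' = φ + σ u` on `J`, with `h = σ u` and `u = (-Δ)⁻¹ (ν - T_φ# μ)`, let `T`
and `T'` send `x` to the minimizers over `Ω` of `c(x, ·) - φ` and `c(x, ·) - φ'`; they are the maps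
`T_φ` and `T_φ'` (`MemS.exists_minimizer`). Since `c(x, ·) - φ` is `lam`-strongly convex, its
quadratic growth at `T x` (`MemS.quadratic_growth`) gives
`φ^c(x) - φ'^c(x) - h(T x) ≤ h(T' x) - h(T x) - (lam / 2) |T' x - T x|²`.
Writing `h(T' x) - h(T x)` as the integral of `∇h` over the segment from `T x` to `T' x`, Young's
inequality bounds the right side by `(2 lam)⁻¹ ∫₀¹ |∇h(T_s x)|² ds` with
`T_s = (1 - s) T + s T'` (`ofReal_sub_le_lintegral`).

To integrate this against `μ` one needs a bound on the density of `T_s# μ`. Almost everywhere `T x`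
is an interior point, because `T# μ` has a density and `∂Ω` is a null set. There `T` inverts the
cocoercive map `y ↦ y - ∇φ y` (`MemS.cocoercive`), so it is strongly monotone with constant `lam`;
`T'` is strongly monotone because `φ'^c` lies in `S_lam`. Hence so is `T_s`, which therefore expands
distances by at least `lam`, and `T_s# μ` has density at most `‖μ‖ lam⁻ᵈ` (this uses only that
Lipschitz maps control Hausdorff measure: `volume_inter_preimage_le`). Altogether the second-order
loss is at most `‖μ‖ lam⁻ᵈ⁻¹ σ² / 2 · ∫ |∇u|²`, while the first-order gain is
`∫ h d(ν - T# μ) = σ ∫ |∇u|²`; for the given step sizes `J` does not decrease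
(`J_le_J_of_isGradientStep`). Here the classical gradient of `u` is identified with the weak one
in the definition of `(-Δ)⁻¹` (`isWeakGradient_gradient`, `IsWeakGradient.ae_eq`).

The functional `I` is `J` with `μ` and `ν` exchanged, a `c`-transform step does not decrease the
dual value because `φ^{cc} ≥ φ`, and along the iteration `D` takes the values of `I` and `J`.
-/

namespace BackAndForth

variable {d : ℕ} {Ω : Set (Rd d)} {lam : ℝ} {φ ψ μ ν : Rd d → ℝ}

/-! ### Expanding maps and Hessian bounds -/

lemma inner_gradient (f : Rd d → ℝ) (x v : Rd d) :
    inner ℝ (gradient f x) v = fderiv ℝ f x v := by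
  simp [gradient]

lemma measurable_gradient (f : Rd d → ℝ) : Measurable (gradient f) :=
  (InnerProductSpace.toDual ℝ (Rd d)).symm.continuous.measurable.comp (measurable_fderiv ℝ f)

lemma cost_sub_cost (x x' y : Rd d) :
    cost x' y - cost x y = ‖x' - x‖ ^ 2 / 2 + inner ℝ (x - y) (x' - x) := by
  have h : y - x' = (y - x) - (x' - x) := by abel
  have h2 : inner ℝ (y - x) (x' - x) = - inner ℝ (x - y) (x' - x) := by
    rw [← inner_neg_left, neg_sub]
  simp only [cost]
  rw [h, norm_sub_sq_real, h2]
  ring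

/-- A map which expands distances on `A` by a factor of at least `c` expands volumes by a factor
of at least `c ^ d`: its inverse is `c⁻¹`-Lipschitz, and Lipschitz maps control Hausdorff
measure. -/
lemma volume_inter_preimage_le {c : ℝ} (hc : 0 < c) {A : Set (Rd d)} {S : Rd d → Rd d}
    (hS : ∀ x ∈ A, ∀ y ∈ A, c * ‖x - y‖ ≤ ‖S x - S y‖) (B : Set (Rd d)) :
    volume (A ∩ S ⁻¹' B) ≤ ENNReal.ofReal ((c⁻¹) ^ d) * volume B := by
  have hK : AntilipschitzWith (Real.toNNReal c⁻¹) (fun x : A => S x) := by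
    refine AntilipschitzWith.of_le_mul_dist fun x y => ?_
    rw [Real.coe_toNNReal _ (by positivity), Subtype.dist_eq, dist_eq_norm, dist_eq_norm,
      inv_mul_eq_div, le_div_iff₀ hc, mul_comm]
    exact hS x x.2 y y.2
  have h1 := hK.hausdorffMeasure_preimage_le (d := (d : ℝ)) (by positivity) B
  rw [← isometry_subtype_coe.hausdorffMeasure_image (Or.inl (by positivity))] at h1
  have h2 : (Subtype.val '' ((fun x : A => S x) ⁻¹' B)) = A ∩ S ⁻¹' B := by
    ext x; simp [and_comm]
  have hd : (d : ℝ) = Module.finrank ℝ (Rd d) := by simp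
  rw [h2] at h1
  obtain ⟨k, hk⟩ : ∃ k : NNReal, (volume : Measure (Rd d)) = k • μH[d] := by
    rw [hd]
    exact ⟨_, Measure.isAddLeftInvariant_eq_smul _ _⟩
  rw [hk]
  simp only [Measure.smul_apply]
  refine (smul_le_smul_of_nonneg_left h1 zero_le).trans (le_of_eq ?_)
  rw [ENNReal.rpow_natCast, ENNReal.ofReal_pow (by positivity)]
  simp only [ENNReal.smul_def, smul_eq_mul, ENNReal.ofReal]
  ring

/-- The derivative of `φ` along a segment, tested against a fixed vector. -/
lemma MemS.hasDerivAt_fderiv_segment (hφ : MemS Ω lam φ) (a b w : Rd d) {t : ℝ}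
    (ht : a + t • (b - a) ∈ interior Ω) :
    HasDerivAt (fun s : ℝ => fderiv ℝ φ (a + s • (b - a)) w)
      (fderiv ℝ (fderiv ℝ φ) (a + t • (b - a)) (b - a) w) t := by
  have h1 : HasDerivAt (fun s : ℝ => a + s • (b - a)) (b - a) t := by
    simpa using ((hasDerivAt_id t).smul_const (b - a)).const_add a
  have h2 := (hφ.differentiableOn_fderiv.differentiableAt
    (isOpen_interior.mem_nhds ht)).hasFDerivAt
  exact (ContinuousLinearMap.apply ℝ ℝ w).hasFDerivAt.comp_hasDerivAt t
    (h2.comp_hasDerivAt t h1)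

lemma MemS.hasDerivAt_segment (hφ : MemS Ω lam φ) (a b : Rd d) {t : ℝ}
    (ht : a + t • (b - a) ∈ interior Ω) :
    HasDerivAt (fun s : ℝ => φ (a + s • (b - a))) (fderiv ℝ φ (a + t • (b - a)) (b - a)) t := by
  have h1 : HasDerivAt (fun s : ℝ => a + s • (b - a)) (b - a) t := by
    simpa using ((hasDerivAt_id t).smul_const (b - a)).const_add a
  exact (hφ.differentiableOn.differentiableAt
    (isOpen_interior.mem_nhds ht)).hasFDerivAt.comp_hasDerivAt t h1

lemma MemS.fderiv_fderiv_comm (hφ : MemS Ω lam φ) {x : Rd d} (hx : x ∈ interior Ω)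
    (v w : Rd d) : fderiv ℝ (fderiv ℝ φ) x v w = fderiv ℝ (fderiv ℝ φ) x w v := by
  refine second_derivative_symmetric_of_eventually (𝕜 := ℝ) (f := φ) (f' := fderiv ℝ φ) ?_
    (hφ.differentiableOn_fderiv.differentiableAt (isOpen_interior.mem_nhds hx)).hasFDerivAt v w
  filter_upwards [isOpen_interior.mem_nhds hx] with y hy
  exact (hφ.differentiableOn.differentiableAt (isOpen_interior.mem_nhds hy)).hasFDerivAt

lemma segment_mem_interior (hΩ : Convex ℝ Ω) {a b : Rd d} (ha : a ∈ interior Ω)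
    (hb : b ∈ interior Ω) {t : ℝ} (ht : t ∈ Icc (0 : ℝ) 1) : a + t • (b - a) ∈ interior Ω :=
  hΩ.interior.add_smul_sub_mem ha hb ht

/-- The upper Hessian bound makes `y ↦ y - ∇φ y` strongly monotone. -/
lemma MemS.fderiv_sub_le (hφ : MemS Ω lam φ) (hΩ : Convex ℝ Ω) {a b : Rd d}
    (ha : a ∈ interior Ω) (hb : b ∈ interior Ω) :
    fderiv ℝ φ b (b - a) - fderiv ℝ φ a (b - a) ≤ (1 - lam) * ‖b - a‖ ^ 2 := by
  have hd : ∀ t ∈ Icc (0 : ℝ) 1, HasDerivAt (fun s : ℝ => fderiv ℝ φ (a + s • (b - a)) (b - a))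
      (fderiv ℝ (fderiv ℝ φ) (a + t • (b - a)) (b - a) (b - a)) t := fun t ht =>
    hφ.hasDerivAt_fderiv_segment a b (b - a) (segment_mem_interior hΩ ha hb ht)
  obtain ⟨t, ht, h⟩ := exists_hasDerivAt_eq_slope _ _ zero_lt_one
    (fun t ht => (hd t ht).continuousAt.continuousWithinAt)
    (fun t ht => hd t (Ioo_subset_Icc_self ht))
  have := hφ.upper _ (segment_mem_interior hΩ ha hb (Ioo_subset_Icc_self ht)) (b - a)
  simp only [one_smul, zero_smul, add_zero, sub_zero, div_one, add_sub_cancel] at h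
  linarith

/-- The two-sided Hessian bound makes `y ↦ y - ∇φ y` cocoercive (an inequality of Baillon–Haddad
type, here on a convex set which need not be the whole space). -/
lemma MemS.cocoercive (hφ : MemS Ω lam φ) (hlam : 0 < lam) (hΩ : Convex ℝ Ω) {a b : Rd d}
    (ha : a ∈ interior Ω) (hb : b ∈ interior Ω) :
    lam * ‖(b - gradient φ b) - (a - gradient φ a)‖ ^ 2 ≤
      inner ℝ ((b - gradient φ b) - (a - gradient φ a)) (b - a) := by
  set w := (b - gradient φ b) - (a - gradient φ a) with hw
  set v := b - a with hv
  -- The mean value theorem applied to `t ↦ ⟨y_t - ∇φ y_t, v - 2 lam w⟩`: if `M = Id - D²φ` then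
  -- `0 ≤ ⟨M (v - lam w), v - lam w⟩ ≤ ⟨M v, v - 2 lam w⟩ + lam |w|²`.
  set z := v - (2 * lam) • w with hz
  have hd : ∀ t ∈ Icc (0 : ℝ) 1,
      HasDerivAt (fun s : ℝ => s * inner ℝ v z - fderiv ℝ φ (a + s • v) z)
      (inner ℝ v z - fderiv ℝ (fderiv ℝ φ) (a + t • v) v z) t := fun t ht => by
    refine HasDerivAt.sub ?_
      (hφ.hasDerivAt_fderiv_segment a b z (segment_mem_interior hΩ ha hb ht))
    simpa using (hasDerivAt_id t).mul_const (inner ℝ v z)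
  obtain ⟨t, ht, h⟩ := exists_hasDerivAt_eq_slope _ _ zero_lt_one
    (fun t ht => (hd t ht).continuousAt.continuousWithinAt)
    (fun t ht => hd t (Ioo_subset_Icc_self ht))
  have hmem := segment_mem_interior hΩ ha hb (Ioo_subset_Icc_self ht)
  rw [← hv] at hmem
  have hu := hφ.upper _ hmem (v - lam • w)
  have hl := hφ.lower _ hmem w
  have hs := hφ.fderiv_fderiv_comm hmem w v
  set Q := fderiv ℝ (fderiv ℝ φ) (a + t • v)
  have hend : inner ℝ v z - (fderiv ℝ φ b z - fderiv ℝ φ a z) = inner ℝ w z := by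
    rw [← inner_gradient, ← inner_gradient, hw, ← inner_sub_left, ← inner_sub_left, hv]
    congr 1
    abel
  simp only [one_smul, zero_smul, add_zero, one_mul, zero_mul, sub_zero, div_one] at h
  have hab : a + v = b := by rw [hv]; abel
  rw [hab] at h
  have h' : inner ℝ v z - Q v z = inner ℝ w z := by rw [h, ← hend]; ring
  rw [norm_sub_sq_real, norm_smul, mul_pow, inner_smul_right, Real.norm_eq_abs, sq_abs] at hu
  simp only [hz, map_sub, map_smul, sub_apply, smul_apply,
    smul_eq_mul, inner_sub_right, inner_smul_right, real_inner_self_eq_norm_sq] at h' hu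
  rw [hs] at hu
  have hl' := mul_le_mul_of_nonneg_left hl (sq_nonneg lam)
  have e : lam ^ 2 * ((1 - lam⁻¹) * ‖w‖ ^ 2) = lam ^ 2 * ‖w‖ ^ 2 - lam * ‖w‖ ^ 2 := by
    field_simp
  have hc : inner ℝ v w = inner ℝ w v := real_inner_comm _ _
  have hnn := mul_nonneg hlam.le (sq_nonneg ‖v - lam • w‖)
  rw [norm_sub_sq_real, norm_smul, mul_pow, inner_smul_right, Real.norm_eq_abs, sq_abs] at hnn
  rw [hc] at h' hu hnn
  linarith

/-! ### The `c`-transform and its minimizers -/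

lemma MemS.convexOn_interior (hφ : MemS Ω lam φ) (hΩ : Convex ℝ Ω) :
    ConvexOn ℝ (interior Ω) (fun y => (1 - lam) / 2 * ‖y‖ ^ 2 - φ y) := by
  refine ⟨hΩ.interior, fun a ha b hb r t hr ht hrt => ?_⟩
  set v := b - a with hv
  have hd : ∀ s ∈ Icc (0 : ℝ) 1,
      HasDerivAt (fun s : ℝ => (1 - lam) / 2 * ‖a + s • v‖ ^ 2 - φ (a + s • v))
      ((1 - lam) * inner ℝ (a + s • v) v - fderiv ℝ φ (a + s • v) v) s := fun s hs => by
    have h1 : HasDerivAt (fun s : ℝ => a + s • v) v s := by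
      simpa using ((hasDerivAt_id s).smul_const v).const_add a
    refine HasDerivAt.sub ?_ (hφ.hasDerivAt_segment a b (segment_mem_interior hΩ ha hb hs))
    exact (h1.norm_sq.const_mul ((1 - lam) / 2)).congr_deriv (by ring)
  have hconv : ConvexOn ℝ (Icc (0 : ℝ) 1)
      (fun s : ℝ => (1 - lam) / 2 * ‖a + s • v‖ ^ 2 - φ (a + s • v)) := by
    refine MonotoneOn.convexOn_of_deriv (convex_Icc 0 1)
      (fun s hs => (hd s hs).continuousAt.continuousWithinAt)
      (fun s hs => (hd s (interior_subset hs)).differentiableAt.differentiableWithinAt) ?_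
    intro s hs s' hs' hss
    rw [(hd s (interior_subset hs)).deriv, (hd s' (interior_subset hs')).deriv]
    rcases hss.eq_or_lt with rfl | hlt
    · rfl
    have h := hφ.fderiv_sub_le hΩ (segment_mem_interior hΩ ha hb (interior_subset hs))
      (segment_mem_interior hΩ ha hb (interior_subset hs'))
    rw [← hv, add_sub_add_left_eq_sub, ← sub_smul, map_smul, map_smul, norm_smul, mul_pow,
      Real.norm_eq_abs, sq_abs, smul_eq_mul, smul_eq_mul] at h
    have hpos : 0 < s' - s := sub_pos.2 hlt
    have h2 : fderiv ℝ φ (a + s' • v) v - fderiv ℝ φ (a + s • v) v ≤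
        (1 - lam) * (s' - s) * ‖v‖ ^ 2 := by
      refine le_of_mul_le_mul_left ?_ hpos
      linarith
    simp only [inner_add_left, inner_smul_left, real_inner_self_eq_norm_sq, conj_trivial]
    linarith
  have h := hconv.2 (left_mem_Icc.2 zero_le_one) (right_mem_Icc.2 zero_le_one) hr ht hrt
  have e : r • a + t • b = a + t • v := by
    rw [hv, eq_sub_of_add_eq hrt]
    module
  simpa [e, hv] using h

/-- In other words, `|y|²/2 - φ y` is `lam`-strongly convex on all of `Ω`: the Hessian bound gives
this in the interior, and continuity extends it to the boundary. -/
lemma MemS.convexOn (hφ : MemS Ω lam φ) (hΩ : Convex ℝ Ω) (hc : IsClosed Ω)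
    (hne : (interior Ω).Nonempty) :
    ConvexOn ℝ Ω (fun y => (1 - lam) / 2 * ‖y‖ ^ 2 - φ y) := by
  refine ⟨hΩ, fun a ha b hb r t hr ht hrt => ?_⟩
  have hcl : closure (interior Ω) = Ω := by
    rw [hΩ.closure_interior_eq_closure_of_nonempty_interior hne, hc.closure_eq]
  have hk : ContinuousOn (fun y => (1 - lam) / 2 * ‖y‖ ^ 2 - φ y) Ω :=
    (by fun_prop : Continuous fun y : Rd d => (1 - lam) / 2 * ‖y‖ ^ 2).continuousOn.sub
      hφ.continuousOn
  have hcl2 : closure (interior Ω ×ˢ interior Ω) = Ω ×ˢ Ω := by rw [closure_prod_eq, hcl]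
  have key := le_on_closure (s := interior Ω ×ˢ interior Ω) (x := (a, b))
    (f := fun p : Rd d × Rd d =>
      (fun y => (1 - lam) / 2 * ‖y‖ ^ 2 - φ y) (r • p.1 + t • p.2))
    (g := fun p : Rd d × Rd d => r • (fun y => (1 - lam) / 2 * ‖y‖ ^ 2 - φ y) p.1 +
      t • (fun y => (1 - lam) / 2 * ‖y‖ ^ 2 - φ y) p.2)
    (fun p hp => (hφ.convexOn_interior hΩ).2 hp.1 hp.2 hr ht hrt) ?_ ?_ ?_
  · exact key
  · rw [hcl2]
    exact hk.comp (by fun_prop) fun p hp => hΩ hp.1 hp.2 hr ht hrt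
  · rw [hcl2]
    exact ((hk.comp continuousOn_fst fun p hp => hp.1).const_smul r).add
      ((hk.comp continuousOn_snd fun p hp => hp.2).const_smul t)
  · rw [hcl2]
    exact ⟨ha, hb⟩

/-- Quadratic growth of `y ↦ c(x, y) - φ y` away from its minimizer on `Ω`, which holds also when
the minimizer lies on the boundary. -/
lemma MemS.quadratic_growth (hφ : MemS Ω lam φ) (hΩ : Convex ℝ Ω) (hc : IsClosed Ω)
    (hne : (interior Ω).Nonempty) {x y : Rd d} (hy : y ∈ Ω)
    (hmin : ∀ z ∈ Ω, cost x y - φ y ≤ cost x z - φ z) {z : Rd d} (hz : z ∈ Ω) :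
    cost x y - φ y + lam / 2 * ‖z - y‖ ^ 2 ≤ cost x z - φ z := by
  have h1 : ∀ t ∈ Ioo (0 : ℝ) 1,
      cost x y - φ y + (1 - t) * (lam / 2 * ‖z - y‖ ^ 2) ≤ cost x z - φ z := by
    -- Compare the minimal value with the value at `y + t (z - y)`, bounded by strong convexity.
    intro t ht
    have ht1 : 0 ≤ 1 - t := sub_nonneg.2 ht.2.le
    have h2 := (hφ.convexOn hΩ hc hne).2 hy hz ht1 ht.1.le (by ring)
    have h3 := hmin _ (hΩ hy hz ht1 ht.1.le (by ring))
    have e : (1 - t) • y + t • z = y + t • (z - y) := by module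
    have e' : y + t • (z - y) - x = (y - x) + t • (z - y) := by abel
    rw [e] at h2 h3
    have ez : z - x = (y - x) + (z - y) := by abel
    have ez' : z = y + (z - y) := by abel
    have nz : ‖z‖ ^ 2 = ‖y‖ ^ 2 + 2 * inner ℝ y (z - y) + ‖z - y‖ ^ 2 := by
      conv_lhs => rw [ez', norm_add_sq_real]
    simp only [cost, smul_eq_mul, nz] at h2 h3 ⊢
    rw [e'] at h3
    rw [ez]
    rw [norm_add_sq_real, inner_smul_right, norm_smul, mul_pow, Real.norm_eq_abs, sq_abs]
      at h2 h3
    rw [norm_add_sq_real]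
    refine le_of_mul_le_mul_left ?_ ht.1
    linarith
  have h4 := le_on_closure (s := Ioo (0 : ℝ) 1) (x := 0) h1 (by fun_prop) (by fun_prop)
    (by rw [closure_Ioo zero_ne_one]; simp)
  simpa using h4

lemma MemS.bddBelow (hφ : MemS Ω lam φ) (hc : IsCompact Ω) (x : Rd d) :
    BddBelow (range fun y : Ω => cost x (y : Rd d) - φ y) := by
  have hcont : ContinuousOn (fun y => cost x y - φ y) Ω :=
    (by unfold cost; fun_prop : Continuous fun y : Rd d => cost x y).continuousOn.sub
      hφ.continuousOn
  have := (hc.image_of_continuousOn hcont).bddBelow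
  rwa [image_eq_range] at this

lemma MemS.cTransform_le (hφ : MemS Ω lam φ) (hc : IsCompact Ω) (x : Rd d) {y : Rd d}
    (hy : y ∈ Ω) : cTransform Ω φ x ≤ cost x y - φ y :=
  ciInf_le (hφ.bddBelow hc x) ⟨y, hy⟩

lemma cTransform_eq_of_isMin {x y : Rd d} (hy : y ∈ Ω)
    (hmin : ∀ z ∈ Ω, cost x y - φ y ≤ cost x z - φ z) : cTransform Ω φ x = cost x y - φ y := by
  have : Nonempty Ω := ⟨⟨y, hy⟩⟩
  refine le_antisymm (ciInf_le ⟨cost x y - φ y, ?_⟩ (⟨y, hy⟩ : Ω)) (le_ciInf fun z => hmin z z.2)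
  rintro _ ⟨z, rfl⟩
  exact hmin z z.2

/-- If `y` and `y'` are minimizers with quadratic growth for `x` and `x'`, adding the two growth
inequalities shows that the minimizer depends monotonically, and Lipschitz continuously, on the
point. -/
lemma lam_mul_sq_le_inner_of_growth {x x' y y' : Rd d}
    (h : cost x y - φ y + lam / 2 * ‖y' - y‖ ^ 2 ≤ cost x y' - φ y')
    (h' : cost x' y' - φ y' + lam / 2 * ‖y - y'‖ ^ 2 ≤ cost x' y - φ y) :
    lam * ‖y' - y‖ ^ 2 ≤ inner ℝ (y' - y) (x' - x) := by
  have h1 := cost_sub_cost x x' y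
  have h2 := cost_sub_cost x x' y'
  have e : inner ℝ (y' - y) (x' - x) = inner ℝ (x - y) (x' - x) - inner ℝ (x - y') (x' - x) := by
    rw [← inner_sub_left]
    congr 1
    abel
  rw [norm_sub_rev y y'] at h'
  linarith

/-- For `φ` in `S_lam`, the map `T_φ = id - ∇φ^c` sends `x` to the unique minimizer of
`c(x, ·) - φ` on `Ω`. The `c`-transform is differentiable because the minimizer is Lipschitz in
`x`. -/
lemma MemS.exists_minimizer (hφ : MemS Ω lam φ) (hlam : 0 < lam) (hΩ : Convex ℝ Ω)
    (hc : IsCompact Ω) (hne : (interior Ω).Nonempty) (x : Rd d) :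
    HasGradientAt (cTransform Ω φ) (x - transportMap Ω φ x) x ∧ transportMap Ω φ x ∈ Ω ∧
      ∀ z ∈ Ω, cost x (transportMap Ω φ x) - φ (transportMap Ω φ x) +
        lam / 2 * ‖z - transportMap Ω φ x‖ ^ 2 ≤ cost x z - φ z := by
  have hex : ∀ x, ∃ y ∈ Ω, ∀ z ∈ Ω,
      cost x y - φ y + lam / 2 * ‖z - y‖ ^ 2 ≤ cost x z - φ z := by
    intro x
    have hcont : ContinuousOn (fun y => cost x y - φ y) Ω :=
      (by unfold cost; fun_prop : Continuous fun y : Rd d => cost x y).continuousOn.sub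
        hφ.continuousOn
    obtain ⟨y, hy, hmin⟩ := hc.exists_isMinOn (hne.mono interior_subset) hcont
    exact ⟨y, hy, fun z hz => hφ.quadratic_growth hΩ hc.isClosed hne hy
      (fun z hz => hmin hz) hz⟩
  choose S hS hSmin using hex
  have hmin : ∀ x, ∀ z ∈ Ω, cost x (S x) - φ (S x) ≤ cost x z - φ z := fun x z hz =>
    le_trans (by have := sq_nonneg ‖z - S x‖; nlinarith) (hSmin x z hz)
  have hval : ∀ x, cTransform Ω φ x = cost x (S x) - φ (S x) := fun x =>
    cTransform_eq_of_isMin (hS x) (hmin x)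
  have hgrad : HasGradientAt (cTransform Ω φ) (x - S x) x := by
    -- The competitors `S x` at `x'` and `S x'` at `x` bound the first-order remainder from above
    -- and from below.
    rw [hasGradientAt_iff_hasFDerivAt]
    refine HasFDerivAt.of_isLittleO ?_
    refine Asymptotics.IsBigO.trans_isLittleO (g := fun x' => ‖x' - x‖ ^ 2) ?_ ?_
    · refine Asymptotics.IsBigO.of_bound (1 / 2 + lam⁻¹) (Filter.Eventually.of_forall fun x' => ?_)
      have hmono := lam_mul_sq_le_inner_of_growth (hSmin x _ (hS x')) (hSmin x' _ (hS x))
      have hle : inner ℝ (S x' - S x) (x' - x) ≤ lam⁻¹ * ‖x' - x‖ ^ 2 := by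
        have hcs := real_inner_le_norm (S x' - S x) (x' - x)
        have h0 := norm_nonneg (S x' - S x)
        have h1 := norm_nonneg (x' - x)
        have hlip : lam * ‖S x' - S x‖ ≤ ‖x' - x‖ := by
          by_contra! hlt
          nlinarith
        rw [inv_mul_eq_div, le_div_iff₀ hlam]
        nlinarith
      have hup := hmin x' _ (hS x)
      have hlow := hmin x _ (hS x')
      have e1 := cost_sub_cost x x' (S x)
      have e2 := cost_sub_cost x x' (S x')
      have e : inner ℝ (S x' - S x) (x' - x) =
          inner ℝ (x - S x) (x' - x) - inner ℝ (x - S x') (x' - x) := by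
        rw [← inner_sub_left]
        congr 1
        abel
      have hpos : 0 ≤ lam⁻¹ * ‖x' - x‖ ^ 2 := by positivity
      have hpos2 : 0 ≤ ‖x' - x‖ ^ 2 := by positivity
      rw [InnerProductSpace.toDual_apply_apply, hval, hval, Real.norm_eq_abs, norm_pow, norm_norm,
        abs_le]
      constructor <;> linarith
    · exact (Asymptotics.isLittleO_norm_pow_id one_lt_two (E' := Rd d)).comp_tendsto
        (tendsto_sub_nhds_zero_iff.2 (Filter.tendsto_id (x := nhds x)))
  have hT : transportMap Ω φ x = S x := by
    rw [transportMap, hgrad.gradient]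
    abel
  rw [hT]
  exact ⟨hgrad, hS x, hSmin x⟩

lemma MemS.continuous_cTransform (hφ : MemS Ω lam φ) (hlam : 0 < lam) (hΩ : Convex ℝ Ω)
    (hc : IsCompact Ω) (hne : (interior Ω).Nonempty) : Continuous (cTransform Ω φ) :=
  continuous_iff_continuousAt.2 fun x =>
    (hφ.exists_minimizer hlam hΩ hc hne x).1.continuousAt

lemma measurable_transportMap : Measurable (transportMap Ω φ) :=
  measurable_id.sub (measurable_gradient _)

/-! ### Monotonicity of the transport maps -/

/-- The first-order condition at a minimizer `y` of `c(x, ·) - φ` in the interior of `Ω`. -/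
lemma MemS.sub_gradient_eq (hφ : MemS Ω lam φ) {x y : Rd d} (hy : y ∈ interior Ω)
    (hmin : ∀ z ∈ Ω, cost x y - φ y ≤ cost x z - φ z) : y - gradient φ y = x := by
  have hloc : IsLocalMin (fun z => cost x z - φ z) y := by
    filter_upwards [isOpen_interior.mem_nhds hy] with z hz
    exact hmin z (interior_subset hz)
  have hdφ := (hφ.differentiableOn.differentiableAt (isOpen_interior.mem_nhds hy)).hasFDerivAt
  have hcost : HasFDerivAt (fun z => cost x z) (innerSL ℝ (y - x)) y := by
    have h := ((hasFDerivAt_id y).sub_const x).norm_sq.const_mul (1 / 2 : ℝ)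
    refine (h.congr_of_eventuallyEq (Filter.Eventually.of_forall fun z => ?_)).congr_fderiv ?_
    · simp only [cost, id]; ring
    · ext v
      simp
  have h0 := hloc.hasFDerivAt_eq_zero (hcost.sub hdφ)
  have hg : gradient φ y = y - x := by
    refine ext_inner_right ℝ fun v => ?_
    rw [inner_gradient]
    have := congrArg (fun L : Rd d →L[ℝ] ℝ => L v) h0
    simp only [sub_apply, innerSL_apply_apply, zero_apply] at this
    linarith
  rw [hg]
  abel

/-- `T_φ` is strongly monotone on the set of points which it sends into the interior of `Ω`: there
it inverts the map `y ↦ y - ∇φ y`, which is cocoercive. -/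
lemma MemS.transportMap_monotone (hφ : MemS Ω lam φ) (hlam : 0 < lam) (hΩ : Convex ℝ Ω)
    (hc : IsCompact Ω) {x x' : Rd d} (hx : transportMap Ω φ x ∈ interior Ω)
    (hx' : transportMap Ω φ x' ∈ interior Ω) :
    lam * ‖x' - x‖ ^ 2 ≤ inner ℝ (transportMap Ω φ x' - transportMap Ω φ x) (x' - x) := by
  have key : ∀ x, transportMap Ω φ x ∈ interior Ω →
      transportMap Ω φ x - gradient φ (transportMap Ω φ x) = x := fun x hx => by
    refine hφ.sub_gradient_eq hx fun z hz => le_trans ?_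
      ((hφ.exists_minimizer hlam hΩ hc ⟨_, hx⟩ x).2.2 z hz)
    have := sq_nonneg ‖z - transportMap Ω φ x‖
    nlinarith
  have h := hφ.cocoercive hlam hΩ hx hx'
  rwa [key x hx, key x' hx', real_inner_comm] at h

/-- If `φ^c` belongs to `S_lam`, then `T_φ` is strongly monotone inside `Ω`. -/
lemma transportMap_monotone_of_memS_cTransform {ψ : Rd d → ℝ} (hψ : MemS Ω lam ψ)
    (hΩ : Convex ℝ Ω) (h : ∀ x ∈ Ω, ψ x = cTransform Ω φ x) {x x' : Rd d}
    (hx : x ∈ interior Ω) (hx' : x' ∈ interior Ω) :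
    lam * ‖x' - x‖ ^ 2 ≤ inner ℝ (transportMap Ω φ x' - transportMap Ω φ x) (x' - x) := by
  have hf : ∀ x ∈ interior Ω, fderiv ℝ (cTransform Ω φ) x = fderiv ℝ ψ x := fun x hx => by
    refine Filter.EventuallyEq.fderiv_eq ?_
    filter_upwards [isOpen_interior.mem_nhds hx] with z hz
    exact (h z (interior_subset hz)).symm
  have h1 := hψ.fderiv_sub_le hΩ hx hx'
  have e : transportMap Ω φ x' - transportMap Ω φ x =
      (x' - x) - (gradient (cTransform Ω φ) x' - gradient (cTransform Ω φ) x) := by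
    simp only [transportMap]; abel
  rw [e, inner_sub_left (x' - x), inner_sub_left (gradient _ _), inner_gradient, inner_gradient,
    hf x hx, hf x' hx', real_inner_self_eq_norm_sq]
  linarith

lemma MemS.exists_norm_gradient_le (hφ : MemS Ω lam φ) (hlam : 0 < lam) (hΩ : Convex ℝ Ω)
    (hc : IsCompact Ω) (hne : (interior Ω).Nonempty) :
    ∃ K, ∀ y ∈ interior Ω, ‖gradient φ y‖ ≤ K := by
  obtain ⟨o, ho⟩ := hne
  obtain ⟨R, hR⟩ := hc.isBounded.exists_norm_le
  refine ⟨R + (‖o - gradient φ o‖ + lam⁻¹ * (R + ‖o‖)), fun y hy => ?_⟩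
  have h := hφ.cocoercive hlam hΩ ho hy
  have hle : ‖(y - gradient φ y) - (o - gradient φ o)‖ ≤ lam⁻¹ * ‖y - o‖ := by
    have hcs := real_inner_le_norm ((y - gradient φ y) - (o - gradient φ o)) (y - o)
    have h0 := norm_nonneg ((y - gradient φ y) - (o - gradient φ o))
    have h1 := norm_nonneg (y - o)
    rw [inv_mul_eq_div, le_div_iff₀ hlam]
    by_contra! hlt
    nlinarith
  have hyR := hR y (interior_subset hy)
  have hyo : lam⁻¹ * ‖y - o‖ ≤ lam⁻¹ * (R + ‖o‖) := by
    gcongr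
    exact (norm_sub_le _ _).trans (by linarith)
  have e : gradient φ y = y - (((y - gradient φ y) - (o - gradient φ o)) +
      (o - gradient φ o)) := by abel
  rw [e]
  refine (norm_sub_le _ _).trans ?_
  have := norm_add_le ((y - gradient φ y) - (o - gradient φ o)) (o - gradient φ o)
  linarith

/-- The push-forward of Lebesgue measure on `A` under a map which expands distances. -/
lemma map_volume_restrict_le {c : ℝ} (hc : 0 < c) {A U : Set (Rd d)} {S : Rd d → Rd d}
    (hSm : Measurable S) (hA : MapsTo S A U)
    (hS : ∀ x ∈ A, ∀ y ∈ A, c * ‖x - y‖ ≤ ‖S x - S y‖) :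
    (volume.restrict A).map S ≤ ENNReal.ofReal ((c⁻¹) ^ d) • volume.restrict U := by
  refine Measure.le_iff.2 fun s hs => ?_
  rw [Measure.map_apply hSm hs, Measure.restrict_apply (hSm hs), Measure.smul_apply,
    Measure.restrict_apply hs, smul_eq_mul]
  refine le_trans (measure_mono ?_) (volume_inter_preimage_le hc hS (s ∩ U))
  rintro x ⟨hx, hxA⟩
  exact ⟨hxA, hx, hA hxA⟩

lemma integrableOn_norm_sq_segment {f : Rd d → Rd d} (hf : Measurable f) {K : ℝ}
    (hK : ∀ z ∈ interior Ω, ‖f z‖ ≤ K) {y v : Rd d}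
    (hmem : ∀ s ∈ Ioo (0 : ℝ) 1, y + s • v ∈ interior Ω) :
    IntegrableOn (fun s : ℝ => ‖f (y + s • v)‖ ^ 2) (Ioo 0 1) := by
  refine Measure.integrableOn_of_bounded (M := K ^ 2) (by simp) ?_ ?_
  · exact (((hf.comp (by fun_prop)).norm).pow_const 2).aestronglyMeasurable
  · filter_upwards [ae_restrict_mem measurableSet_Ioo] with s hs
    rw [norm_pow, norm_norm]
    exact pow_le_pow_left₀ (norm_nonneg _) (hK _ (hmem s hs)) 2

/-- The increment of `h` along a segment, bounded by Young's inequality. -/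
lemma ofReal_sub_le_lintegral (hlam : 0 < lam) (hΩ : Convex ℝ Ω) {h : Rd d → ℝ}
    (hcont : ContinuousOn h Ω) (hdiff : DifferentiableOn ℝ h (interior Ω)) {K : ℝ}
    (hK : ∀ z ∈ interior Ω, ‖gradient h z‖ ≤ K) {y y' : Rd d}
    (hy : y ∈ interior Ω) (hy' : y' ∈ Ω) :
    ENNReal.ofReal (h y' - h y - lam / 2 * ‖y' - y‖ ^ 2) ≤ ENNReal.ofReal ((2 * lam)⁻¹) *
      ∫⁻ s in Ioo (0 : ℝ) 1, ENNReal.ofReal (‖gradient h (y + s • (y' - y))‖ ^ 2) := by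
  set v := y' - y with hv
  have hmem : ∀ s ∈ Ioo (0 : ℝ) 1, y + s • v ∈ interior Ω := fun s hs => by
    have := hΩ.combo_interior_self_mem_interior hy hy' (sub_pos.2 hs.2) hs.1.le (by ring)
    convert this using 1
    rw [hv]; module
  have hmemΩ : ∀ s ∈ Icc (0 : ℝ) 1, y + s • v ∈ Ω := fun s hs =>
    hΩ.add_smul_sub_mem (interior_subset hy) hy' hs
  have hgm : Measurable (gradient h) := measurable_gradient h
  have hint := integrableOn_norm_sq_segment hgm hK hmem
  have hint1 : IntegrableOn (fun s : ℝ => inner ℝ (gradient h (y + s • v)) v) (Ioo 0 1) := by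
    refine Measure.integrableOn_of_bounded (M := K * ‖v‖) (by simp) ?_ ?_
    · exact ((hgm.comp (by fun_prop)).inner measurable_const).aestronglyMeasurable
    · filter_upwards [ae_restrict_mem measurableSet_Ioo] with s hs
      refine (norm_inner_le_norm _ _).trans ?_
      gcongr
      exact hK _ (hmem s hs)
  have hftc := intervalIntegral.integral_eq_sub_of_hasDerivAt_of_le (zero_le_one' ℝ)
    (f := fun s : ℝ => h (y + s • v)) (f' := fun s => inner ℝ (gradient h (y + s • v)) v)
    (hcont.comp (by fun_prop) hmemΩ) (fun s hs => by
      have h1 : HasDerivAt (fun s : ℝ => y + s • v) v s := by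
        simpa using ((hasDerivAt_id s).smul_const v).const_add y
      rw [inner_gradient]
      exact (hdiff.differentiableAt (isOpen_interior.mem_nhds
        (hmem s hs))).hasFDerivAt.comp_hasDerivAt s h1)
    ((intervalIntegrable_iff_integrableOn_Ioo_of_le zero_le_one).2 hint1)
  rw [intervalIntegral.integral_of_le zero_le_one, integral_Ioc_eq_integral_Ioo] at hftc
  have hyv : y + v = y' := by rw [hv]; abel
  simp only [one_smul, zero_smul, add_zero, hyv] at hftc
  have hle : h y' - h y ≤
      lam / 2 * ‖v‖ ^ 2 + (2 * lam)⁻¹ * ∫ s in Ioo (0 : ℝ) 1, ‖gradient h (y + s • v)‖ ^ 2 := by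
    rw [← hftc, ← integral_const_mul]
    have hc : lam / 2 * ‖v‖ ^ 2 = ∫ s in Ioo (0 : ℝ) 1, lam / 2 * ‖v‖ ^ 2 := by simp
    rw [hc, ← integral_add (integrable_const _) (hint.const_mul _)]
    refine setIntegral_mono hint1 (by exact (integrable_const _).add (hint.const_mul _))
      fun s => ?_
    refine (real_inner_le_norm _ _).trans ?_
    have h2 := sq_nonneg (lam * ‖v‖ - ‖gradient h (y + s • v)‖)
    have h3 : (2 * lam) * (lam / 2 * ‖v‖ ^ 2 + (2 * lam)⁻¹ * ‖gradient h (y + s • v)‖ ^ 2) =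
        lam ^ 2 * ‖v‖ ^ 2 + ‖gradient h (y + s • v)‖ ^ 2 := by field_simp
    refine le_of_mul_le_mul_left ?_ (by positivity : 0 < 2 * lam)
    rw [h3]
    linarith
  rw [← ofReal_integral_eq_lintegral_ofReal hint
      (Filter.Eventually.of_forall fun s => by positivity),
    ← ENNReal.ofReal_mul (by positivity)]
  exact ENNReal.ofReal_le_ofReal (by linarith)

/-! ### Densities and weak gradients -/

lemma IsProbDensity.interior_nonempty (hμ : IsProbDensity Ω μ) (hΩ : Convex ℝ Ω) :
    (interior Ω).Nonempty := by
  by_contra hne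
  rw [not_nonempty_iff_eq_empty] at hne
  have h0 : volume Ω = 0 := by
    refine measure_mono_null ?_ (hΩ.addHaar_frontier volume)
    rw [frontier, hne, sdiff_empty]
    exact subset_closure
  have := hμ.integral_eq_one
  rw [Measure.restrict_eq_zero.2 h0, integral_zero_measure] at this
  exact zero_ne_one this

lemma IsProbDensity.integrableOn (hμ : IsProbDensity Ω μ) : IntegrableOn μ Ω := by
  by_contra h
  have := hμ.integral_eq_one
  rw [integral_undef h] at this
  exact zero_ne_one this

lemma integral_densityMeasure (hμ : IsProbDensity Ω μ) (g : Rd d → ℝ) :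
    ∫ x, g x ∂(densityMeasure Ω μ) = ∫ x in Ω, g x * μ x := by
  rw [densityMeasure, integral_withDensity_eq_integral_toReal_smul
    hμ.measurable.ennreal_ofReal (by simp)]
  congr 1
  funext x
  rw [ENNReal.toReal_ofReal (hμ.nonneg x), smul_eq_mul, mul_comm]

lemma densityMeasure_absolutelyContinuous (Ω : Set (Rd d)) (μ : Rd d → ℝ) :
    densityMeasure Ω μ ≪ volume.restrict Ω := withDensity_absolutelyContinuous _ _

lemma ae_mem_interior (hΩ : Convex ℝ Ω) : ∀ᵐ x ∂volume.restrict Ω, x ∈ interior Ω := by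
  rw [← Measure.restrict_congr_set (interior_ae_eq_of_null_frontier (hΩ.addHaar_frontier volume))]
  exact ae_restrict_mem isOpen_interior.measurableSet

lemma densityMeasure_le (hμ_bdd : MemLp μ ∞ (volume.restrict Ω)) :
    densityMeasure Ω μ ≤ ENNReal.ofReal (linftyNorm Ω μ) • volume := by
  have hC : ENNReal.ofReal (linftyNorm Ω μ) = eLpNorm μ ∞ (volume.restrict Ω) :=
    ENNReal.ofReal_toReal hμ_bdd.eLpNorm_ne_top
  refine le_trans (withDensity_mono (g := fun _ => ENNReal.ofReal (linftyNorm Ω μ)) ?_) ?_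
  · rw [hC, eLpNorm_exponent_top]
    filter_upwards [ae_le_eLpNormEssSup (f := μ) (μ := volume.restrict Ω)] with x hx
    exact (Real.ofReal_le_enorm _).trans hx
  · rw [withDensity_const]
    exact Measure.le_iff'.2 fun s => mul_le_mul_right (Measure.restrict_le_self s) _

/-- Classical differentiability inside `Ω` with a bounded gradient gives a weak gradient. -/
lemma isWeakGradient_gradient (hc : IsCompact Ω) {h : Rd d → ℝ}
    (hcont : ContinuousOn h Ω) (hdiff : DifferentiableOn ℝ h (interior Ω)) {K : ℝ}
    (hK : ∀ z ∈ interior Ω, ‖gradient h z‖ ≤ K) : IsWeakGradient Ω h (gradient h) := by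
  intro η hη hηc hηs e
  have hη1 : ContDiff ℝ 1 η := hη.of_le (by exact_mod_cast le_top)
  have hη0 : ∀ x, x ∉ interior Ω → η x = 0 := fun x hx => by
    by_contra hne
    exact hx (hηs (subset_tsupport _ hne))
  have hη' : ∀ x, x ∉ interior Ω → fderiv ℝ η x = 0 := fun x hx => by
    by_contra hne
    exact hx (hηs (tsupport_fderiv_subset ℝ (subset_tsupport _ hne)))
  have hout : ∀ x, x ∉ Ω → x ∉ interior Ω := fun x hx hx' => hx (interior_subset hx')
  have hηcont := hη1.continuous
  have hηe : Continuous fun x => fderiv ℝ η x e :=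
    (hη1.continuous_fderiv one_ne_zero).clm_apply continuous_const
  rw [setIntegral_eq_integral_of_forall_compl_eq_zero fun x hx => by simp [hη' x (hout x hx)],
    setIntegral_eq_integral_of_forall_compl_eq_zero fun x hx => by simp [hη0 x (hout x hx)],
    integral_mul_fderiv_eq_neg_fderiv_mul_of_integrable]
  · congr 2
    funext x
    rw [inner_gradient, mul_comm]
  · refine Integrable.mono' ((hηcont.integrable_of_hasCompactSupport hηc).norm.const_mul (K * ‖e‖))
      ((measurable_fderiv_apply_const ℝ h e).mul hηcont.measurable).aestronglyMeasurable
      (Filter.Eventually.of_forall fun x => ?_)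
    by_cases hx : x ∈ interior Ω
    · rw [norm_mul, ← inner_gradient]
      gcongr
      exact (norm_inner_le_norm _ _).trans (by gcongr; exact hK x hx)
    · simp [hη0 x hx]
  · refine (integrableOn_iff_integrable_of_support_subset fun x hx => ?_).1
      ((hcont.mul hηe.continuousOn).integrableOn_compact hc)
    by_contra hx'
    exact hx (by simp [hη' x (hout x hx')])
  · refine (integrableOn_iff_integrable_of_support_subset fun x hx => ?_).1
      ((hcont.mul hηcont.continuousOn).integrableOn_compact hc)
    by_contra hx'
    exact hx (by simp [hη0 x (hout x hx')])
  · exact fun x hx => hdiff.differentiableAt (isOpen_interior.mem_nhds (hηs hx))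
  · exact fun x _ => hη1.differentiable one_ne_zero x

/-- Weak gradients are unique. -/
lemma IsWeakGradient.ae_eq (hΩ : Convex ℝ Ω) {u : Rd d → ℝ} {G H : Rd d → Rd d}
    (hG : IsWeakGradient Ω u G) (hH : IsWeakGradient Ω u H) (hGi : IntegrableOn G Ω)
    (hHi : IntegrableOn H Ω) : G =ᵐ[volume.restrict Ω] H := by
  have hae := interior_ae_eq_of_null_frontier (hΩ.addHaar_frontier (volume : Measure (Rd d)))
  have key : ∀ᵐ x ∂volume, x ∈ interior Ω → G x - H x = 0 := by
    refine isOpen_interior.ae_eq_zero_of_integral_contDiff_smul_eq_zero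
      ((hGi.sub hHi).mono_set interior_subset).locallyIntegrableOn ?_
    intro η hη hηc hηs
    have hη0 : ∀ x, x ∉ Ω → η x = 0 := fun x hx => by
      by_contra hne
      exact hx (interior_subset (hηs (subset_tsupport _ hne)))
    rw [← setIntegral_eq_integral_of_forall_compl_eq_zero (s := Ω)
      fun x hx => by simp [hη0 x hx]]
    obtain ⟨M, hM⟩ := hη.continuous.bounded_above_of_compact_support hηc
    have hbdd : ∀ {F : Rd d → Rd d}, IntegrableOn F Ω → IntegrableOn (fun x => η x • F x) Ω :=
      fun hF => hF.bdd_smul M hη.continuous.aestronglyMeasurable (Filter.Eventually.of_forall hM)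
    refine ext_inner_right ℝ fun e => ?_
    have hin : ∀ {F : Rd d → Rd d}, IntegrableOn F Ω →
        inner ℝ (∫ x in Ω, η x • F x) e = ∫ x in Ω, η x * inner ℝ (F x) e := fun {F} hF => by
      rw [real_inner_comm, ← integral_inner (hbdd hF)]
      congr 1
      funext x
      rw [inner_smul_right, real_inner_comm]
    have h1 := hG η hη hηc hηs e
    have h2 := hH η hη hηc hηs e
    simp only [smul_sub]
    rw [integral_sub (hbdd hGi) (hbdd hHi), inner_sub_left, hin hGi, hin hHi, inner_zero_left]
    linarith
  rw [Filter.EventuallyEq, ← Measure.restrict_congr_set hae,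
    ae_restrict_iff' isOpen_interior.measurableSet]
  filter_upwards [key] with x hx hxi
  exact sub_eq_zero.1 (hx hxi)

/-! ### Ascent along the gradient of `J` -/

lemma MemS.continuous_transportMap (hφ : MemS Ω lam φ) (hlam : 0 < lam) (hΩ : Convex ℝ Ω)
    (hc : IsCompact Ω) (hne : (interior Ω).Nonempty) : Continuous (transportMap Ω φ) := by
  refine (LipschitzWith.of_dist_le_mul (K := Real.toNNReal lam⁻¹) fun x' x => ?_).continuous
  have hx := hφ.exists_minimizer hlam hΩ hc hne x
  have hx' := hφ.exists_minimizer hlam hΩ hc hne x'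
  have h := lam_mul_sq_le_inner_of_growth (hx.2.2 _ hx'.2.1) (hx'.2.2 _ hx.2.1)
  have hcs := real_inner_le_norm (transportMap Ω φ x' - transportMap Ω φ x) (x' - x)
  have h0 := norm_nonneg (transportMap Ω φ x' - transportMap Ω φ x)
  have h1 := norm_nonneg (x' - x)
  rw [Real.coe_toNNReal _ (by positivity), dist_eq_norm, dist_eq_norm, inv_mul_eq_div,
    le_div_iff₀ hlam]
  by_contra! hlt
  nlinarith

/-- If `T` and `T'` are strongly monotone on `A`, so are the interpolations between them; hence
these expand distances, and compress the measure with density `μ` to a bounded density. -/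
lemma lintegral_interpolation_le (hlam : 0 < lam) (hμ_bdd : MemLp μ ∞ (volume.restrict Ω))
    {A : Set (Rd d)} {T T' : Rd d → Rd d} (hT : Measurable T) (hT' : Measurable T')
    (hA : ∀ x ∈ A, ∀ x' ∈ A, lam * ‖x' - x‖ ^ 2 ≤ inner ℝ (T x' - T x) (x' - x))
    (hA' : ∀ x ∈ A, ∀ x' ∈ A, lam * ‖x' - x‖ ^ 2 ≤ inner ℝ (T' x' - T' x) (x' - x))
    {F : Rd d → ℝ≥0∞} (hF : Measurable F) {s : ℝ} (hs : s ∈ Ioo (0 : ℝ) 1) {U : Set (Rd d)}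
    (hAU : ∀ x ∈ A, T x + s • (T' x - T x) ∈ U) :
    ∫⁻ x in A, F (T x + s • (T' x - T x)) ∂(densityMeasure Ω μ) ≤
      ENNReal.ofReal (linftyNorm Ω μ * (lam⁻¹) ^ d) * ∫⁻ y in U, F y := by
  have hSm : Measurable fun x => T x + s • (T' x - T x) := by fun_prop
  have hexp : ∀ x ∈ A, ∀ y ∈ A, lam * ‖x - y‖ ≤
      ‖(T x + s • (T' x - T x)) - (T y + s • (T' y - T y))‖ := by
    intro x hx y hy
    have e : (T x + s • (T' x - T x)) - (T y + s • (T' y - T y)) =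
        (1 - s) • (T x - T y) + s • (T' x - T' y) := by module
    have h1 := mul_le_mul_of_nonneg_left (hA y hy x hx) (sub_pos.2 hs.2).le
    have h2 := mul_le_mul_of_nonneg_left (hA' y hy x hx) hs.1.le
    have h3 : lam * ‖x - y‖ ^ 2 ≤
        inner ℝ ((T x + s • (T' x - T x)) - (T y + s • (T' y - T y))) (x - y) := by
      rw [e, inner_add_left, inner_smul_left, inner_smul_left]
      simp only [conj_trivial]
      linarith
    have hcs := h3.trans (real_inner_le_norm _ _)
    rcases (norm_nonneg (x - y)).eq_or_lt with h0 | h0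
    · rw [← h0, mul_zero]
      exact norm_nonneg _
    · refine le_of_mul_le_mul_right ?_ h0
      linarith
  calc ∫⁻ x in A, F (T x + s • (T' x - T x)) ∂(densityMeasure Ω μ)
      ≤ ∫⁻ x in A, F (T x + s • (T' x - T x)) ∂(ENNReal.ofReal (linftyNorm Ω μ) • volume) :=
        lintegral_mono' (Measure.restrict_mono le_rfl (densityMeasure_le hμ_bdd)) le_rfl
    _ = ENNReal.ofReal (linftyNorm Ω μ) *
          ∫⁻ y, F y ∂(volume.restrict A).map (fun x => T x + s • (T' x - T x)) := by
        rw [Measure.restrict_smul, lintegral_smul_measure, lintegral_map hF hSm, smul_eq_mul]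
    _ ≤ ENNReal.ofReal (linftyNorm Ω μ) *
          ∫⁻ y, F y ∂(ENNReal.ofReal ((lam⁻¹) ^ d) • volume.restrict U) := by
        gcongr
        exact map_volume_restrict_le hlam hSm hAU hexp
    _ = ENNReal.ofReal (linftyNorm Ω μ * (lam⁻¹) ^ d) * ∫⁻ y in U, F y := by
        rw [lintegral_smul_measure, smul_eq_mul, ← mul_assoc,
          ENNReal.ofReal_mul (show 0 ≤ linftyNorm Ω μ from ENNReal.toReal_nonneg)]

/-- The second-order estimate for `J`: the loss in the first-order expansion of the `c`-transform
is controlled by the `Ḣ¹` norm of the increment. -/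
lemma integral_remainder_le (hΩ : Convex ℝ Ω) (hc : IsCompact Ω) (hlam : 0 < lam)
    (hμ : IsProbDensity Ω μ) (hμ_bdd : MemLp μ ∞ (volume.restrict Ω)) {φ' ψ' ρ : Rd d → ℝ}
    (hφ : MemS Ω lam φ) (hφ' : MemS Ω lam φ') (hψ' : MemS Ω lam ψ')
    (hψφ : ∀ x ∈ Ω, ψ' x = cTransform Ω φ' x)
    (hρ : (densityMeasure Ω μ).map (transportMap Ω φ) = densityMeasure Ω ρ)
    {h : Rd d → ℝ} (hh : h = fun y => φ' y - φ y) {K : ℝ}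
    (hK : ∀ z ∈ interior Ω, ‖gradient h z‖ ≤ K) :
    ∫ x, (cTransform Ω φ x - cTransform Ω φ' x - h (transportMap Ω φ x)) ∂(densityMeasure Ω μ) ≤
      (2 * lam)⁻¹ * (linftyNorm Ω μ * (lam⁻¹) ^ d) * ∫ y in Ω, ‖gradient h y‖ ^ 2 := by
  have hne := hμ.interior_nonempty hΩ
  have hae := interior_ae_eq_of_null_frontier (hΩ.addHaar_frontier (volume : Measure (Rd d)))
  have hC : 0 ≤ linftyNorm Ω μ := ENNReal.toReal_nonneg
  have hE : 0 ≤ ∫ y in Ω, ‖gradient h y‖ ^ 2 := integral_nonneg fun y => by positivity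
  have hrhs : 0 ≤ (2 * lam)⁻¹ * (linftyNorm Ω μ * (lam⁻¹) ^ d) *
    ∫ y in Ω, ‖gradient h y‖ ^ 2 := by positivity
  set m := densityMeasure Ω μ with hm
  have : SFinite m := by rw [hm, densityMeasure]; infer_instance
  set T := transportMap Ω φ with hTdef
  set T' := transportMap Ω φ' with hTdef'
  have hTm : Measurable T := measurable_transportMap
  have hTm' : Measurable T' := measurable_transportMap
  have hgm : Measurable (gradient h) := measurable_gradient h
  set F : Rd d → ℝ≥0∞ := fun z => ENNReal.ofReal (‖gradient h z‖ ^ 2)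
  have hFm : Measurable F := (hgm.norm.pow_const 2).ennreal_ofReal
  -- For a non-integrable remainder the integral on the left is `0` by convention.
  by_cases hint : Integrable (fun x => cTransform Ω φ x - cTransform Ω φ' x - h (T x)) m
  swap
  · rw [integral_undef hint]
    exact hrhs
  have hcont : ContinuousOn h Ω := hh ▸ hφ'.continuousOn.sub hφ.continuousOn
  have hdiff : DifferentiableOn ℝ h (interior Ω) :=
    hh ▸ hφ'.differentiableOn.sub hφ.differentiableOn
  set A : Set (Rd d) := interior Ω ∩ T ⁻¹' interior Ω
  have hAm : MeasurableSet A :=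
    isOpen_interior.measurableSet.inter (hTm isOpen_interior.measurableSet)
  -- Since the push-forward has a density, `T` sends almost no point to the null set `∂Ω`.
  have hA_ae : ∀ᵐ x ∂m, x ∈ A := by
    have h1 : ∀ᵐ x ∂m, x ∈ interior Ω :=
      (densityMeasure_absolutelyContinuous Ω μ).ae_le (ae_mem_interior hΩ)
    have h2 : ∀ᵐ y ∂(m.map T), y ∈ interior Ω := by
      rw [hρ]
      exact (densityMeasure_absolutelyContinuous Ω ρ).ae_le (ae_mem_interior hΩ)
    filter_upwards [h1, ae_of_ae_map hTm.aemeasurable h2] with x hx hx'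
    exact ⟨hx, hx'⟩
  have hmono : ∀ x ∈ A, ∀ x' ∈ A, lam * ‖x' - x‖ ^ 2 ≤ inner ℝ (T x' - T x) (x' - x) :=
    fun x hx x' hx' => hφ.transportMap_monotone hlam hΩ hc hx.2 hx'.2
  have hmono' : ∀ x ∈ A, ∀ x' ∈ A, lam * ‖x' - x‖ ^ 2 ≤ inner ℝ (T' x' - T' x) (x' - x) :=
    fun x hx x' hx' => transportMap_monotone_of_memS_cTransform hψ' hΩ hψφ hx.1 hx'.1
  have hpt : ∀ x ∈ A, ENNReal.ofReal (cTransform Ω φ x - cTransform Ω φ' x - h (T x)) ≤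
      ENNReal.ofReal ((2 * lam)⁻¹) * ∫⁻ s in Ioo (0 : ℝ) 1, F (T x + s • (T' x - T x)) := by
    intro x hx
    obtain ⟨-, hTx, hmin⟩ := hφ.exists_minimizer hlam hΩ hc hne x
    obtain ⟨-, hTx', hmin'⟩ := hφ'.exists_minimizer hlam hΩ hc hne x
    refine le_trans (ENNReal.ofReal_le_ofReal ?_)
      (ofReal_sub_le_lintegral hlam hΩ hcont hdiff hK hx.2 hTx')
    have e1 := hφ.cTransform_le hc x hTx
    have e2 : cTransform Ω φ' x = cost x (T' x) - φ' (T' x) :=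
      cTransform_eq_of_isMin hTx' fun z hz => le_trans
        (by have := mul_nonneg hlam.le (sq_nonneg ‖z - T' x‖); linarith) (hmin' z hz)
    have e3 := hmin _ hTx'
    rw [e2, hh]
    simp only [← hTdef, ← hTdef'] at e1 e3 ⊢
    linarith
  have hupper : ∫⁻ x, ENNReal.ofReal (cTransform Ω φ x - cTransform Ω φ' x - h (T x)) ∂m ≤
      ENNReal.ofReal ((2 * lam)⁻¹ * (linftyNorm Ω μ * (lam⁻¹) ^ d) *
        ∫ y in Ω, ‖gradient h y‖ ^ 2) := by
    calc ∫⁻ x, ENNReal.ofReal (cTransform Ω φ x - cTransform Ω φ' x - h (T x)) ∂m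
        = ∫⁻ x in A, ENNReal.ofReal (cTransform Ω φ x - cTransform Ω φ' x - h (T x)) ∂m := by
          rw [Measure.restrict_eq_self_of_ae_mem hA_ae]
      _ ≤ ∫⁻ x in A, (ENNReal.ofReal ((2 * lam)⁻¹) *
            ∫⁻ s in Ioo (0 : ℝ) 1, F (T x + s • (T' x - T x))) ∂m :=
          setLIntegral_mono' hAm hpt
      _ = ENNReal.ofReal ((2 * lam)⁻¹) * ∫⁻ s in Ioo (0 : ℝ) 1,
            ∫⁻ x in A, F (T x + s • (T' x - T x)) ∂m := by
          rw [lintegral_const_mul' _ _ ENNReal.ofReal_ne_top, lintegral_lintegral_swap]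
          exact (hFm.comp (by fun_prop)).aemeasurable
      _ ≤ ENNReal.ofReal ((2 * lam)⁻¹) * ∫⁻ s in Ioo (0 : ℝ) 1,
            ENNReal.ofReal (linftyNorm Ω μ * (lam⁻¹) ^ d) * ∫⁻ y in interior Ω, F y := by
          refine mul_le_mul_right (setLIntegral_mono' measurableSet_Ioo fun s hs => ?_) _
          refine lintegral_interpolation_le hlam hμ_bdd hTm hTm' hmono hmono' hFm hs
            fun x hx => ?_
          have := hΩ.combo_interior_self_mem_interior hx.2
            (hφ'.exists_minimizer hlam hΩ hc hne x).2.1 (sub_pos.2 hs.2) hs.1.le (by ring)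
          convert this using 1
          module
      _ = ENNReal.ofReal ((2 * lam)⁻¹ * (linftyNorm Ω μ * (lam⁻¹) ^ d) *
            ∫ y in Ω, ‖gradient h y‖ ^ 2) := by
          have hi : IntegrableOn (fun y => ‖gradient h y‖ ^ 2) (interior Ω) := by
            refine Measure.integrableOn_of_bounded (M := K ^ 2)
              (measure_mono interior_subset |>.trans_lt hc.measure_lt_top).ne
              (hgm.norm.pow_const 2).aestronglyMeasurable ?_
            filter_upwards [ae_restrict_mem isOpen_interior.measurableSet] with y hy
            rw [norm_pow, norm_norm]
            exact pow_le_pow_left₀ (norm_nonneg _) (hK _ hy) 2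
          rw [← Measure.restrict_congr_set hae, ENNReal.ofReal_mul
            (show 0 ≤ (2 * lam)⁻¹ * (linftyNorm Ω μ * (lam⁻¹) ^ d) by positivity),
            ENNReal.ofReal_mul (show 0 ≤ (2 * lam)⁻¹ by positivity),
            ofReal_integral_eq_lintegral_ofReal hi
            (Filter.Eventually.of_forall fun y => by positivity), setLIntegral_const,
            Real.volume_Ioo, sub_zero, ENNReal.ofReal_one, mul_one, mul_assoc]
  rw [integral_eq_lintegral_pos_part_sub_lintegral_neg_part hint]
  refine (sub_le_self _ ENNReal.toReal_nonneg).trans ?_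
  exact ENNReal.toReal_le_of_le_ofReal hrhs hupper

/-- The ascent property: a step of size at most `‖μ‖⁻¹ lam ^ (d + 1)` along the `Ḣ¹`-gradient does
not decrease `J`. -/
lemma J_le_J_of_isGradientStep (hΩ : Convex ℝ Ω) (hc : IsCompact Ω) (hlam : 0 < lam)
    (hμ : IsProbDensity Ω μ) (hμ_bdd : MemLp μ ∞ (volume.restrict Ω))
    (hν : IsProbDensity Ω ν) {φ' ψ' : Rd d → ℝ}
    (hφ : MemS Ω lam φ) (hφ' : MemS Ω lam φ') (hψ' : MemS Ω lam ψ')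
    (hψφ : ∀ x ∈ Ω, ψ' x = cTransform Ω φ' x) {σ : ℝ} (hσ : 0 < σ)
    (hσ' : σ ≤ (linftyNorm Ω μ)⁻¹ * lam ^ (d + 1)) (hstep : IsGradientStep Ω μ ν σ φ φ') :
    J Ω μ ν φ ≤ J Ω μ ν φ' := by
  obtain ⟨u, ⟨ρ, hρ, hmap, G, hG, hweak⟩, hu⟩ := hstep
  have hne := hμ.interior_nonempty hΩ
  have hΩm := hc.measurableSet
  have : IsFiniteMeasure (volume.restrict Ω) := ⟨by simpa using hc.measure_lt_top⟩
  obtain ⟨h, hh⟩ : ∃ h : Rd d → ℝ, h = fun y => φ' y - φ y := ⟨_, rfl⟩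
  have hhu : ∀ y ∈ Ω, h y = σ * u y := fun y hy => by
    rw [hh]
    simp only [hu y hy]
    ring
  have hcont : ContinuousOn h Ω := hh ▸ hφ'.continuousOn.sub hφ.continuousOn
  have hdiff : DifferentiableOn ℝ h (interior Ω) :=
    hh ▸ hφ'.differentiableOn.sub hφ.differentiableOn
  obtain ⟨K₁, hK₁⟩ := hφ.exists_norm_gradient_le hlam hΩ hc hne
  obtain ⟨K₂, hK₂⟩ := hφ'.exists_norm_gradient_le hlam hΩ hc hne
  have hgrad : ∀ z ∈ interior Ω, gradient h z = gradient φ' z - gradient φ z := fun z hz => by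
    have h1 := hφ.differentiableOn.differentiableAt (isOpen_interior.mem_nhds hz)
    have h2 := hφ'.differentiableOn.differentiableAt (isOpen_interior.mem_nhds hz)
    rw [gradient, gradient, gradient, ← map_sub, hh, fderiv_fun_sub h2 h1]
  have hK : ∀ z ∈ interior Ω, ‖gradient h z‖ ≤ K₂ + K₁ := fun z hz => by
    rw [hgrad z hz]
    exact (norm_sub_le _ _).trans (add_le_add (hK₂ z hz) (hK₁ z hz))
  have hgm : Measurable (gradient h) := measurable_gradient h
  have hgi : IntegrableOn (gradient h) Ω := by
    refine Measure.integrableOn_of_bounded (M := K₂ + K₁) hc.measure_lt_top.ne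
      hgm.aestronglyMeasurable ?_
    filter_upwards [ae_mem_interior hΩ] with y hy using hK y hy
  have hGi : IntegrableOn G Ω := hG.memLp_gradient.integrable one_le_two
  have hwG : IsWeakGradient Ω h (fun x => σ • G x) := by
    intro η hη hηc hηs e
    have h1 := hG.isWeakGradient η hη hηc hηs e
    have e1 : ∫ x in Ω, h x * fderiv ℝ η x e = σ * ∫ x in Ω, u x * fderiv ℝ η x e := by
      rw [← integral_const_mul]
      refine setIntegral_congr_fun hΩm fun x hx => ?_
      simp only [hhu x hx, mul_assoc]
    rw [e1, h1, mul_neg, ← integral_const_mul]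
    congr 2
    funext x
    rw [inner_smul_left, conj_trivial]
    ring
  -- The classical gradient of the increment agrees with `σ` times the weak gradient of `u`.
  have hgG := (isWeakGradient_gradient hc hcont hdiff hK).ae_eq hΩ hwG hgi (hGi.smul σ)
  set E := ∫ x in Ω, inner ℝ (G x) (G x) with hE
  have hE0 : 0 ≤ E := integral_nonneg fun x => real_inner_self_nonneg
  have hgE : ∫ y in Ω, ‖gradient h y‖ ^ 2 = σ ^ 2 * E := by
    rw [hE, ← integral_const_mul]
    refine integral_congr_ae ?_
    filter_upwards [hgG] with x hx
    rw [hx, norm_smul, mul_pow, Real.norm_eq_abs, sq_abs, real_inner_self_eq_norm_sq]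
  have hint : ∀ {g θ : Rd d → ℝ}, ContinuousOn g Ω → IsProbDensity Ω θ →
      IntegrableOn (fun x => g x * θ x) Ω := fun hg hθ => hθ.integrableOn.continuousOn_mul hg hc
  have hfu : (∫ y in Ω, h y * ν y) - ∫ y in Ω, h y * ρ y = σ * E := by
    rw [← integral_sub (hint hcont hν) (hint hcont hρ), hE, (hweak u G hG).2,
      ← integral_const_mul]
    refine setIntegral_congr_fun hΩm fun x hx => ?_
    simp only [hhu x hx]
    ring
  have hpush : ∫ y in Ω, h y * ρ y = ∫ x in Ω, h (transportMap Ω φ x) * μ x := by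
    rw [← integral_densityMeasure hρ, ← hmap, integral_map measurable_transportMap.aemeasurable,
      integral_densityMeasure hμ]
    rw [hmap]
    exact (hcont.aestronglyMeasurable hΩm).mono_ac (densityMeasure_absolutelyContinuous Ω ρ)
  have hrem := integral_remainder_le hΩ hc hlam hμ hμ_bdd hφ hφ' hψ' hψφ hmap hh hK
  rw [integral_densityMeasure hμ, hgE] at hrem
  have hT := hφ.continuous_transportMap hlam hΩ hc hne
  have hhT : ContinuousOn (fun x => h (transportMap Ω φ x)) Ω :=
    hcont.comp hT.continuousOn fun x _ => (hφ.exists_minimizer hlam hΩ hc hne x).2.1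
  have hc1 := (hφ.continuous_cTransform hlam hΩ hc hne).continuousOn (s := Ω)
  have hc2 := (hφ'.continuous_cTransform hlam hΩ hc hne).continuousOn (s := Ω)
  have hsplit : ∫ x in Ω, (cTransform Ω φ x - cTransform Ω φ' x - h (transportMap Ω φ x)) * μ x =
      (∫ x in Ω, cTransform Ω φ x * μ x) - (∫ x in Ω, cTransform Ω φ' x * μ x) -
        ∫ x in Ω, h (transportMap Ω φ x) * μ x := by
    simp only [sub_mul]
    rw [integral_sub (by exact (hint hc1 hμ).sub (hint hc2 hμ)) (hint hhT hμ),
      integral_sub (hint hc1 hμ) (hint hc2 hμ)]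
  have hφν : ∫ y in Ω, h y * ν y = (∫ y in Ω, φ' y * ν y) - ∫ y in Ω, φ y * ν y := by
    rw [← integral_sub (hint hφ'.continuousOn hν) (hint hφ.continuousOn hν), hh]
    simp only [sub_mul]
  have hC : 0 ≤ linftyNorm Ω μ := ENNReal.toReal_nonneg
  have hCσ : σ * linftyNorm Ω μ ≤ lam ^ (d + 1) := by
    rcases hC.eq_or_lt with h0 | h0
    · rw [← h0, mul_zero]
      positivity
    · rwa [inv_mul_eq_div, le_div_iff₀ h0] at hσ'
  -- The first-order gain `σ E` is at least twice the second-order loss.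
  have hfinal : (2 * lam)⁻¹ * (linftyNorm Ω μ * (lam⁻¹) ^ d) * (σ ^ 2 * E) ≤ σ * E := by
    have e : (2 * lam)⁻¹ * (linftyNorm Ω μ * (lam⁻¹) ^ d) * (σ ^ 2 * E) =
        (σ * linftyNorm Ω μ / lam ^ (d + 1)) * (σ * E) / 2 := by
      rw [inv_pow]
      field_simp
      ring
    have h1 : σ * linftyNorm Ω μ / lam ^ (d + 1) ≤ 1 := (div_le_one (by positivity)).2 hCσ
    have h2 : 0 ≤ σ * E := by positivity
    rw [e]
    nlinarith
  unfold J
  linarith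

/-! ### The dual functionals along the iteration -/

lemma I_eq_J_swap : I Ω μ ν ψ = J Ω ν μ ψ := add_comm _ _

/-- Replacing `φ` by `φ^{cc} ≥ φ` does not decrease the dual functional. -/
lemma J_le_I_of_eq_cTransform (hΩ : Convex ℝ Ω) (hc : IsCompact Ω) (hlam : 0 < lam)
    (hμ : IsProbDensity Ω μ) (hν : IsProbDensity Ω ν) (hφ : MemS Ω lam φ) (hψ : MemS Ω lam ψ)
    (h : ∀ x ∈ Ω, ψ x = cTransform Ω φ x) : J Ω μ ν φ ≤ I Ω μ ν ψ := by
  have hne := hμ.interior_nonempty hΩ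
  unfold J I
  refine add_le_add ?_ (le_of_eq (setIntegral_congr_fun hc.measurableSet fun x hx => ?_))
  · refine setIntegral_mono_on (hν.integrableOn.continuousOn_mul hφ.continuousOn hc)
      (hν.integrableOn.continuousOn_mul
        (hψ.continuous_cTransform hlam hΩ hc hne).continuousOn hc) hc.measurableSet fun y hy => ?_
    refine mul_le_mul_of_nonneg_right ?_ (hν.nonneg y)
    have : Nonempty Ω := ⟨⟨y, hy⟩⟩
    refine le_ciInf fun x => ?_
    have h1 := hφ.cTransform_le hc (x : Rd d) hy
    rw [h x x.2]
    have h2 : cost y x = cost (x : Rd d) y := by rw [cost, cost, norm_sub_rev]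
    rw [h2]
    linarith
  · simp only [h x hx]

lemma D_eq_of_mem (h : (φ, ψ) ∈ constraintSet Ω) :
    D Ω μ ν φ ψ = (((∫ y in Ω, φ y * ν y) + ∫ x in Ω, ψ x * μ x : ℝ) : EReal) := by
  rw [D, constraintIndicator, if_pos h, sub_zero]

lemma D_eq_J (hc : IsCompact Ω) (hφ : MemS Ω lam φ) (h : ∀ x ∈ Ω, ψ x = cTransform Ω φ x) :
    D Ω μ ν φ ψ = (J Ω μ ν φ : EReal) := by
  rw [D_eq_of_mem, J]
  · congr 2
    exact setIntegral_congr_fun hc.measurableSet fun x hx => by simp only [h x hx]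
  · intro x hx y hy
    have := hφ.cTransform_le hc x hy
    simp only [h x hx]
    linarith

lemma D_eq_I (hc : IsCompact Ω) (hψ : MemS Ω lam ψ) (h : ∀ x ∈ Ω, φ x = cTransform Ω ψ x) :
    D Ω μ ν φ ψ = (I Ω μ ν ψ : EReal) := by
  rw [D_eq_of_mem, I]
  · congr 2
    exact setIntegral_congr_fun hc.measurableSet fun x hx => by simp only [h x hx]
  · intro x hx y hy
    have := hψ.cTransform_le hc y hx
    have h2 : cost y x = cost x y := by rw [cost, cost, norm_sub_rev]
    simp only [h y hy]
    linarith

lemma cTransform_zero {x : Rd d} (hx : x ∈ Ω) (hψ : ∀ y ∈ Ω, ψ y = 0) :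
    cTransform Ω ψ x = 0 := by
  rw [cTransform_eq_of_isMin hx fun z hz => ?_]
  · simp [cost, hψ x hx]
  · rw [hψ x hx, hψ z hz]
    simp only [cost, sub_self, norm_zero]
    have := sq_nonneg ‖z - x‖
    linarith

end BackAndForth

theorem proposition3p5 {d : ℕ} (Ω : Set (BackAndForth.Rd d))
    (hΩ_compact : IsCompact Ω) (hΩ_convex : Convex ℝ Ω)
    (μ ν : BackAndForth.Rd d → ℝ)
    (hμ : BackAndForth.IsProbDensity Ω μ) (hν : BackAndForth.IsProbDensity Ω ν)
    (hμ_bdd : MemLp μ ∞ (volume.restrict Ω)) (hν_bdd : MemLp ν ∞ (volume.restrict Ω))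
    (lam : ℝ) (hlam : 0 < lam)
    (σ τ : ℕ → ℝ)
    (hσ : ∀ n, 0 < σ n ∧ σ n ≤ (BackAndForth.linftyNorm Ω μ)⁻¹ * lam ^ (d + 1))
    (hτ : ∀ n, 0 < τ n ∧ τ n ≤ (BackAndForth.linftyNorm Ω ν)⁻¹ * lam ^ (d + 1))
    (φ φh ψ ψh : ℕ → BackAndForth.Rd d → ℝ)
    (hbf : BackAndForth.IsBackAndForth Ω μ ν σ τ φ φh ψ ψh)
    (hS : ∀ n, BackAndForth.MemS Ω lam (φ n) ∧ BackAndForth.MemS Ω lam (φh n) ∧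
      BackAndForth.MemS Ω lam (ψ n) ∧ BackAndForth.MemS Ω lam (ψh n)) :
    ∀ n,
      (BackAndForth.D Ω μ ν (φ (n + 1)) (ψ (n + 1)) ≥ BackAndForth.D Ω μ ν (φh n) (ψh n) ∧
        BackAndForth.D Ω μ ν (φh n) (ψh n) ≥ BackAndForth.D Ω μ ν (φ n) (ψ n)) ∧
      (BackAndForth.I Ω μ ν (ψ (n + 1)) ≥ BackAndForth.I Ω μ ν (ψh n) ∧
        BackAndForth.I Ω μ ν (ψh n) ≥ BackAndForth.J Ω μ ν (φh n) ∧
        BackAndForth.J Ω μ ν (φh n) ≥ BackAndForth.J Ω μ ν (φ n) ∧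
        BackAndForth.J Ω μ ν (φ n) ≥ BackAndForth.I Ω μ ν (ψ n)) := by
  -- At `n = 0` the identity `φ = ψ^c` holds because the `c`-transform of `0` vanishes on `Ω`.
  have hφψ : ∀ n, ∀ x ∈ Ω, φ n x = BackAndForth.cTransform Ω (ψ n) x := by
    intro n x hx
    cases n with
    | zero => rw [hbf.φ_zero x hx, BackAndForth.cTransform_zero hx hbf.ψ_zero]
    | succ n => exact hbf.φ_succ n x hx
  intro n
  obtain ⟨hφ, hφh, hψ, hψh⟩ := hS n
  obtain ⟨hφ', -, hψ', -⟩ := hS (n + 1)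
  have h1 : BackAndForth.I Ω μ ν (ψh n) ≤ BackAndForth.I Ω μ ν (ψ (n + 1)) := by
    rw [BackAndForth.I_eq_J_swap, BackAndForth.I_eq_J_swap]
    exact BackAndForth.J_le_J_of_isGradientStep hΩ_convex hΩ_compact hlam hν hν_bdd hμ hψh hψ'
      hφ' (hφψ (n + 1)) (hτ n).1 (hτ n).2 (hbf.ψ_succ n)
  have h2 := BackAndForth.J_le_I_of_eq_cTransform hΩ_convex hΩ_compact hlam hμ hν hφh hψh
    (hbf.ψ_half n)
  have h3 := BackAndForth.J_le_J_of_isGradientStep hΩ_convex hΩ_compact hlam hμ hμ_bdd hν hφ hφh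
    hψh (hbf.ψ_half n) (hσ n).1 (hσ n).2 (hbf.φ_half n)
  have h4 : BackAndForth.I Ω μ ν (ψ n) ≤ BackAndForth.J Ω μ ν (φ n) := by
    have h := BackAndForth.J_le_I_of_eq_cTransform hΩ_convex hΩ_compact hlam hν hμ hψ hφ (hφψ n)
    rwa [← BackAndForth.I_eq_J_swap, BackAndForth.I_eq_J_swap (ψ := φ n)] at h
  rw [BackAndForth.D_eq_I hΩ_compact hψ' (hφψ (n + 1)), BackAndForth.D_eq_I hΩ_compact hψ (hφψ n),
    BackAndForth.D_eq_J hΩ_compact hφh (hbf.ψ_half n)]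
  exact ⟨⟨EReal.coe_le_coe_iff.2 (h2.trans h1), EReal.coe_le_coe_iff.2 (h4.trans h3)⟩,
    h1, h2, h3, h4⟩
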